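/- Let $G$ be a connected graph (of arbitrary, possibly uncountable, cardinality). A spanning tree $T$ of $G$ with root $r$ is called normal if for every edge $uv$ of $G$ the vertices $u,v$ are comparable in the tree order of $T$, where $x\le_T y$ means that $x$ lies on the unique path from $r$ to $y$ in $T$. A set $U\subseteq V(G)$ is called $TK^{\aleph_0}$-dispersed in $G$ if for every subgraph $K\subseteq G$ that is a subdivision of the countably infinite complete graph $K^{\aleph_0}$ there is a finite set $S\subseteq V(G)$ such that every path in $G$ from a vertex of $U$ to a vertex of $K$ (including paths consisting of a single vertex) contains a vertex of $S$. Then $G$ has a normal spanning tree (for some choice of root) if and only if $V(G)=\bigcup_{n\in\mathbb{N}}U_n$ for some sets $U_n\subseteq V(G)$, $n\in\mathbb{N}$, each of which is $TK^{\aleph_0}$-dispersed in $G$. -/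

import Mathlib

namespace SimpleGraph

variable {V : Type*}

/-- The tree order of a tree `T` with root `r`: `u ≤ v` if `u` lies on the (unique) path
from `r` to `v` in `T`. -/
def TreeLE (T : SimpleGraph V) (r u v : V) : Prop :=
  ∃ p : T.Walk r v, p.IsPath ∧ u ∈ p.support

/-- `T`, rooted at `r`, is a normal spanning tree of `G`: it is a tree on all vertices of `G`,
a subgraph of `G`, and the end vertices of any edge of `G` are comparable in its tree order. -/
structure IsNormalSpanningTree (G T : SimpleGraph V) (r : V) : Prop where
  isTree : T.IsTree
  le : T ≤ G
  comparable : ∀ u v : V, G.Adj u v → TreeLE T r u v ∨ TreeLE T r v u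

/-- `G` has a normal spanning tree. -/
def HasNormalSpanningTree (G : SimpleGraph V) : Prop :=
  ∃ (T : SimpleGraph V) (r : V), IsNormalSpanningTree G T r

/-- The vertices `b i` and the paths `P i j` (for `i < j`) form a subdivision of the clique with
vertex set `ℕ`: the branch vertices `b i` are distinct, `P i j` is a path of `G` joining `b i` to
`b j`, no inner vertex of a path is a branch vertex, and distinct paths share no inner vertices.
(The values `P i j` for `j ≤ i` play no role.) -/
structure IsCliqueSubdivision (G : SimpleGraph V) (b : ℕ → V)
    (P : ∀ i j : ℕ, G.Walk (b i) (b j)) : Prop where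
  injective : Function.Injective b
  isPath : ∀ i j : ℕ, i < j → (P i j).IsPath
  branch : ∀ i j m : ℕ, i < j → b m ∈ (P i j).support → m = i ∨ m = j
  disjoint : ∀ i j k l : ℕ, i < j → k < l → (i, j) ≠ (k, l) →
    ∀ v : V, v ∈ (P i j).support → v ∈ (P k l).support → ∃ m : ℕ, v = b m

/-- The subgraph `K` of `G` is a subdivided infinite clique (a subdivision of the countably
infinite complete graph): it is the union of the paths of such a subdivision. -/
def IsSubdividedInfiniteClique (G : SimpleGraph V) (K : G.Subgraph) : Prop :=
  ∃ (b : ℕ → V) (P : ∀ i j : ℕ, G.Walk (b i) (b j)), IsCliqueSubdivision G b P ∧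
    K = ⨆ (i : ℕ) (j : ℕ) (_ : i < j), (P i j).toSubgraph

/-- The vertex set `S` separates the vertex sets `A` and `B` in `G`: every path of `G` from a
vertex of `A` to a vertex of `B` (possibly a single vertex) meets `S`. -/
def Separates (G : SimpleGraph V) (S A B : Set V) : Prop :=
  ∀ a ∈ A, ∀ c ∈ B, ∀ p : G.Walk a c, p.IsPath → ∃ s ∈ S, s ∈ p.support

/-- `U` is `TK^{ℵ₀}`-dispersed in `G`: every subdivided infinite clique in `G` can be separated
from `U` by a finite set of vertices. -/
def IsTKDispersed (G : SimpleGraph V) (U : Set V) : Prop :=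
  ∀ K : G.Subgraph, IsSubdividedInfiniteClique G K →
    ∃ S : Set V, S.Finite ∧ Separates G S U K.verts

end SimpleGraph

namespace SimpleGraph

variable {V : Type*}

/-! Forward direction: in a normal tree order, two incomparable vertices are separated by the finite
set of their common lower bounds. Branch vertices of a subdivided infinite clique cannot be finitely
separated, so they form a chain of unbounded height. Given `n`, pick a branch vertex of height above
`n`. The finitely many vertices of height at most `n` below it cut off a cone that contains no
vertex of height at most `n` but all except finitely many vertices of the clique
(`IsCliqueSubdivision.finite_outside_cone`). Hence each set of vertices of bounded height is
dispersed (`IsNormalOrder.isTKDispersed`).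

Backward direction: Zorn's lemma is applied to normal trees in `G` such that the neighbours of each
component of the complement form a finite chain. A tree that is not spanning can be enlarged inside
a component `D`, by a connected finite piece adjacent to all neighbours of `D` (`exists_develops`).
The danger lies in limits, where a component might acquire infinitely many neighbours. The order
`Develops` therefore records the connected pieces: in the bad case, infinitely many neighbours
together with infinitely many disjoint pieces yield a subdivided infinite clique, and all pieces
meet a fixed `U k`, contradicting dispersedness (`boundary_finite_of_isChain`). -/

/-! ### Normal orders, cones and heights. -/

/-- A relation that behaves like the tree order of a normal spanning tree of `G`. -/
structure IsNormalOrder (G : SimpleGraph V) (le : V → V → Prop) : Prop where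
  refl : ∀ x, le x x
  trans : ∀ {x y z}, le x y → le y z → le x z
  antisymm : ∀ {x y}, le x y → le y x → x = y
  chain : ∀ {x y z}, le y x → le z x → le y z ∨ le z y
  finite : ∀ x, {y | le y x}.Finite
  comparable : ∀ {x y}, G.Adj x y → le x y ∨ le y x

theorem IsNormalSpanningTree.isNormalOrder {G T : SimpleGraph V} {r : V}
    (h : IsNormalSpanningTree G T r) : IsNormalOrder G (TreeLE T r) := by
  have uniq : ∀ {v : V} (p q : T.Walk r v), p.IsPath → q.IsPath → p = q := fun p q hp hq =>
    congrArg Subtype.val ((h.isTree.isAcyclic.subsingleton_path _ _).elim ⟨p, hp⟩ ⟨q, hq⟩)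
  have ex : ∀ v : V, ∃ p : T.Walk r v, p.IsPath := fun v =>
    (h.isTree.1.preconnected r v).exists_isPath
  have mem : ∀ {u v : V} (p : T.Walk r v), p.IsPath → TreeLE T r u v → u ∈ p.support := by
    rintro u v p hp ⟨q, hq, hu⟩
    rwa [uniq p q hp hq]
  classical
  refine ⟨fun x => ?_, ?_, ?_, ?_, fun x => ?_, fun {x y} => h.comparable x y⟩
  · obtain ⟨p, hp⟩ := ex x
    exact ⟨p, hp, p.end_mem_support⟩
  · rintro x y z hxy ⟨p, hp, hy⟩
    exact ⟨p, hp, p.support_takeUntil_subset_support hy (mem _ (hp.takeUntil hy) hxy)⟩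
  · rintro x y hxy ⟨p, hp, hy⟩
    by_contra hne
    obtain ⟨q, hq, hx⟩ := hxy
    have e1 := uniq _ _ (hp.takeUntil hy) hq
    have e2 := uniq _ _ (hq.takeUntil hx) hp
    have l1 := p.length_takeUntil_lt_length hy (Ne.symm hne)
    have l2 := q.length_takeUntil_lt_length hx hne
    rw [e1] at l1
    rw [e2] at l2
    omega
  · rintro x y z ⟨p, hp, hy⟩ hz
    replace hz := mem p hp hz
    by_cases hzy : z ∈ (p.takeUntil y hy).support
    · exact Or.inr ⟨_, hp.takeUntil hy, hzy⟩
    · have hz' : z ∈ (p.dropUntil y hy).support := by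
        rw [← p.take_spec hy, Walk.mem_support_append_iff] at hz
        exact hz.resolve_left hzy
      refine Or.inl ⟨(p.takeUntil y hy).append ((p.dropUntil y hy).takeUntil z hz'), ?_, ?_⟩
      · refine Walk.IsPath.of_append_left (q := (p.dropUntil y hy).dropUntil z hz') ?_
        rw [← Walk.append_assoc, Walk.take_spec, Walk.take_spec]
        exact hp
      · rw [Walk.mem_support_append_iff]
        exact Or.inl (Walk.end_mem_support _)
  · obtain ⟨p, hp⟩ := ex x
    exact (List.finite_toSet p.support).subset fun y hy => mem p hp hy

namespace IsNormalOrder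

variable {G : SimpleGraph V} {le : V → V → Prop}

/-- A step up an edge keeps the witness `y`. A step down to `v` makes `y` and `v` comparable, both
being below the old vertex; either `y` still works, or `v` is below `b` and becomes the witness. -/
theorem mem_cone_of_walk (h : IsNormalOrder G le) {b : V} {Q : V → Prop} {z z' : V}
    (p : G.Walk z z') (hp : ∀ y ∈ p.support, le y b → Q y) (hz : ∃ y, le y b ∧ le y z ∧ Q y) :
    ∃ y, le y b ∧ le y z' ∧ Q y := by
  induction p with
  | nil => exact hz
  | cons hadj q ih =>
    rename_i u v w
    refine ih (fun y hy => hp y (by simp [hy])) ?_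
    obtain ⟨y, hyb, hyu, hQ⟩ := hz
    rcases h.comparable hadj with hc | hc
    · exact ⟨y, hyb, h.trans hyu hc, hQ⟩
    · rcases h.chain hyu hc with hy | hy
      · exact ⟨y, hyb, hy, hQ⟩
      · exact ⟨v, h.trans hy hyb, h.refl v, hp v (by simp) (h.trans hy hyb)⟩

/-- The number of vertices below a given one. -/
noncomputable def height (_ : IsNormalOrder G le) (x : V) : ℕ := {y | le y x}.ncard

theorem height_mono (h : IsNormalOrder G le) {x y : V} (hxy : le x y) : h.height x ≤ h.height y :=
  Set.ncard_le_ncard (fun _ hz => h.trans hz hxy) (h.finite y)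

theorem eq_of_height_eq (h : IsNormalOrder G le) {x y : V} (hxy : le x y)
    (he : h.height x = h.height y) : x = y := by
  have := Set.eq_of_subset_of_ncard_le (s := {z | le z x}) (t := {z | le z y})
    (fun _ hz => h.trans hz hxy) he.ge (h.finite y)
  have hy : y ∈ {z | le z x} := this ▸ h.refl y
  exact h.antisymm hxy hy

end IsNormalOrder

/-! ### Subdivided infinite cliques inside a normal order. -/

namespace IsCliqueSubdivision

variable {G : SimpleGraph V} {b : ℕ → V} {P : ∀ i j : ℕ, G.Walk (b i) (b j)}

/-- Paths starting at `b i` share no vertex other than `b i`, so each `s ∈ S` blocks at most one of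
them. -/
theorem finite_meeting (h : IsCliqueSubdivision G b P) {S : Set V} (hS : S.Finite) {i : ℕ}
    (hi : b i ∉ S) : {k | i < k ∧ ∃ s ∈ S, s ∈ (P i k).support}.Finite := by
  have : {k | i < k ∧ ∃ s ∈ S, s ∈ (P i k).support} =
      ⋃ s ∈ S, {k | i < k ∧ s ∈ (P i k).support} := by
    ext k
    simp only [Set.mem_ofPred_eq, Set.mem_iUnion]
    exact ⟨fun ⟨h1, s, h2, h3⟩ => ⟨s, h2, h1, h3⟩, fun ⟨s, h2, h1, h3⟩ => ⟨h1, s, h2, h3⟩⟩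
  rw [this]
  refine hS.biUnion fun s hs => Set.Subsingleton.finite ?_
  rintro k ⟨hk, hsk⟩ l ⟨hl, hsl⟩
  by_contra hne
  obtain ⟨m, rfl⟩ := h.disjoint i k i l hk hl (by simp [hne]) s hsk hsl
  have hm : m ≠ i := by rintro rfl; exact hi hs
  have h1 := (h.branch i k m hk hsk).resolve_left hm
  have h2 := (h.branch i l m hl hsl).resolve_left hm
  exact hne (h1 ▸ h2)

/-- For all but finitely many `k`, the detour through `b k` avoids `S`. -/
theorem exists_walk_avoiding (h : IsCliqueSubdivision G b P) {S : Set V} (hS : S.Finite) {i j : ℕ}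
    (hi : b i ∉ S) (hj : b j ∉ S) : ∃ p : G.Walk (b i) (b j), ∀ s ∈ p.support, s ∉ S := by
  obtain ⟨k, hk⟩ := ((h.finite_meeting hS hi).union ((h.finite_meeting hS hj).union
    (Set.finite_Iic (i + j)))).exists_notMem
  simp only [Set.mem_union, Set.mem_ofPred_eq, Set.mem_Iic, not_or, not_and, not_exists] at hk
  obtain ⟨h1, h2, h3⟩ := hk
  refine ⟨(P i k).append (P j k).reverse, fun s hs hsS => ?_⟩
  rw [Walk.mem_support_append_iff, Walk.support_reverse, List.mem_reverse] at hs
  rcases hs with hs | hs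
  · exact h1 (by omega) s hsS hs
  · exact h2 (by omega) s hsS hs

theorem comparable_branch (h : IsCliqueSubdivision G b P) {le : V → V → Prop}
    (ho : IsNormalOrder G le) (i j : ℕ) : le (b i) (b j) ∨ le (b j) (b i) := by
  by_contra hc
  rw [not_or] at hc
  obtain ⟨p, hp⟩ := h.exists_walk_avoiding (S := {y | le y (b i) ∧ le y (b j)})
    ((ho.finite (b i)).subset fun _ hy => hy.1) (i := i) (j := j)
    (fun hh => hc.1 hh.2) (fun hh => hc.2 hh.1)
  obtain ⟨y, -, hy, hn⟩ := ho.mem_cone_of_walk (b := b i) (Q := fun y => ¬ le y (b j)) p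
    (fun y hy h1 h2 => hp y hy ⟨h1, h2⟩) ⟨b i, ho.refl _, ho.refl _, hc.1⟩
  exact hn hy

theorem exists_height_gt (h : IsCliqueSubdivision G b P) {le : V → V → Prop}
    (ho : IsNormalOrder G le) (n : ℕ) : ∃ i, n < ho.height (b i) := by
  by_contra! hc
  have hinj : Function.Injective fun i => ho.height (b i) := by
    intro i j hij
    rcases h.comparable_branch ho i j with hle | hle
    · exact h.injective (ho.eq_of_height_eq hle hij)
    · exact h.injective (ho.eq_of_height_eq hle hij.symm).symm
  exact Set.infinite_range_of_injective hinj
    ((Set.finite_Iic n).subset (Set.range_subset_iff.2 hc))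

/-- All but finitely many vertices of a subdivided clique lie in a single cone of a normal order. -/
theorem finite_outside_cone (h : IsCliqueSubdivision G b P) {S W : Set V} (hS : S.Finite)
    (hb : ∀ i, b i ∉ S → b i ∈ W)
    (hW : ∀ {z z' : V} (p : G.Walk z z'), z ∈ W → (∀ y ∈ p.support, y ∉ S) → z' ∈ W) :
    ((⨆ (i : ℕ) (j : ℕ) (_ : i < j), (P i j).toSubgraph).verts \ W).Finite := by
  classical
  -- On a path outside `bad`, at most one vertex lies in `S`, and it is an end; every other vertex
  -- is reached from the opposite end without meeting `S`. The finitely many bad paths are simply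
  -- discarded.
  let bad : Set (ℕ × ℕ) := (b ⁻¹' S) ×ˢ (b ⁻¹' S) ∪
    ⋃ s ∈ S, {ij | ij.1 < ij.2 ∧ s ∈ (P ij.1 ij.2).support ∧ ∀ m, s ≠ b m}
  have hbad : bad.Finite := by
    have hf : (b ⁻¹' S).Finite := hS.preimage h.injective.injOn
    refine (hf.prod hf).union (hS.biUnion fun s _ => Set.Subsingleton.finite ?_)
    rintro ⟨i, j⟩ ⟨h1, h2, h3⟩ ⟨k, l⟩ ⟨h4, h5, -⟩
    by_contra hne
    obtain ⟨m, hm⟩ := h.disjoint i j k l h1 h4 hne s h2 h5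
    exact h3 m hm
  refine (hS.union (hbad.biUnion fun ij _ => List.finite_toSet (P ij.1 ij.2).support)).subset ?_
  rintro z ⟨hz, hzW⟩
  simp only [Subgraph.verts_iSup, Set.mem_iUnion, Walk.mem_verts_toSubgraph] at hz
  obtain ⟨i, j, hij, hz⟩ := hz
  by_contra hc
  simp only [Set.mem_union, Set.mem_iUnion, not_or, not_exists] at hc
  obtain ⟨hzS, hz2⟩ := hc
  have hgood : (i, j) ∉ bad := fun hh => hz2 (i, j) hh hz
  have hin : ∀ y ∈ (P i j).support, y ∈ S → y = b i ∨ y = b j := by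
    intro y hy hyS
    by_contra hcon
    rw [not_or] at hcon
    refine hgood (Or.inr (Set.mem_biUnion hyS ⟨hij, hy, ?_⟩))
    rintro m rfl
    rcases h.branch i j m hij hy with rfl | rfl
    · exact hcon.1 rfl
    · exact hcon.2 rfl
  have hzb : ∀ m, z ≠ b m := by
    rintro m rfl
    exact hzW (hb m hzS)
  by_cases hi : b i ∈ S
  · have hj : b j ∉ S := fun hj => hgood (Or.inl ⟨hi, hj⟩)
    have hz' : z ∈ (P i j).reverse.support := by simpa using hz
    have hp := (h.isPath i j hij).reverse
    refine hzW (hW ((P i j).reverse.takeUntil z hz') (hb j hj) fun y hy hyS => ?_)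
    rcases hin y (by simpa using Walk.support_takeUntil_subset_support _ hz' hy) hyS with rfl | rfl
    · exact Walk.endpoint_notMem_support_takeUntil hp hz' (hzb i).symm hy
    · exact hj hyS
  · refine hzW (hW ((P i j).takeUntil z hz) (hb i hi) fun y hy hyS => ?_)
    rcases hin y (Walk.support_takeUntil_subset_support _ hz hy) hyS with rfl | rfl
    · exact hi hyS
    · exact Walk.endpoint_notMem_support_takeUntil (h.isPath i j hij) hz (hzb j).symm hy

end IsCliqueSubdivision

theorem IsNormalOrder.isTKDispersed {G : SimpleGraph V} {le : V → V → Prop}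
    (h : IsNormalOrder G le) (n : ℕ) : G.IsTKDispersed {v | h.height v ≤ n} := by
  rintro K ⟨b, P, hP, rfl⟩
  obtain ⟨i, hi⟩ := hP.exists_height_gt h n
  let S : Set V := {y | le y (b i) ∧ h.height y ≤ n}
  let W : Set V := {z | ∃ y, le y (b i) ∧ le y z ∧ n < h.height y}
  have hS : S.Finite := (h.finite (b i)).subset fun _ hy => hy.1
  have hW : ∀ {z z' : V} (p : G.Walk z z'), z ∈ W → (∀ y ∈ p.support, y ∉ S) → z' ∈ W :=
    fun p hz hp => h.mem_cone_of_walk p (fun y hy hyb => not_le.1 fun hn => hp y hy ⟨hyb, hn⟩) hz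
  have hb : ∀ j, b j ∉ S → b j ∈ W := by
    intro j hj
    rcases hP.comparable_branch h i j with hc | hc
    · exact ⟨b i, h.refl _, hc, hi⟩
    · exact ⟨b j, hc, h.refl _, not_le.1 fun hn => hj ⟨hc, hn⟩⟩
  -- The separator is `S` plus the finitely many clique vertices outside `W`: a path missing it
  -- starts, seen from the clique, in `W`, and stays there, where all heights exceed `n`.
  refine ⟨_, hS.union (hP.finite_outside_cone hS hb hW), fun a ha c hc p _ => ?_⟩
  by_contra! hcon
  have hcW : c ∈ W := by
    by_contra hcW
    exact hcon c (Or.inr ⟨hc, hcW⟩) p.end_mem_support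
  obtain ⟨y, -, hya, hy⟩ := hW p.reverse hcW fun y hy hyS => hcon y (Or.inl hyS) (by simpa using hy)
  exact absurd (h.height_mono hya) (not_le.2 (lt_of_le_of_lt ha hy))

theorem HasNormalSpanningTree.exists_isTKDispersed {G : SimpleGraph V}
    (h : G.HasNormalSpanningTree) :
    ∃ U : ℕ → Set V, (∀ n, G.IsTKDispersed (U n)) ∧ ⋃ n, U n = Set.univ := by
  obtain ⟨T, r, hT⟩ := h
  refine ⟨_, hT.isNormalOrder.isTKDispersed, Set.eq_univ_of_forall fun v => ?_⟩
  exact Set.mem_iUnion.2 ⟨_, le_refl (hT.isNormalOrder.height v)⟩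

/-! ### Components of the complement of a vertex set and their neighbours. -/

/-- Any two vertices of `C` are joined by a walk inside `C`. -/
def ConnectedIn (G : SimpleGraph V) (C : Set V) : Prop :=
  ∀ a ∈ C, ∀ b ∈ C, ∃ w : G.Walk a b, ∀ z ∈ w.support, z ∈ C

/-- The vertices that can be reached from `u` by walks avoiding `A`. -/
def componentAvoiding (G : SimpleGraph V) (A : Set V) (u : V) : Set V :=
  {v | ∃ w : G.Walk u v, ∀ z ∈ w.support, z ∉ A}

/-- The neighbours in `A` of the component of `G - A` containing `u`. -/
def boundary (G : SimpleGraph V) (A : Set V) (u : V) : Set V :=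
  {x | x ∈ A ∧ ∃ w ∈ G.componentAvoiding A u, G.Adj x w}

section Components

variable {G : SimpleGraph V} {A B : Set V} {u v w x : V}

theorem self_mem_componentAvoiding (hu : u ∉ A) : u ∈ G.componentAvoiding A u :=
  ⟨Walk.nil, by simpa using hu⟩

theorem notMem_of_mem_componentAvoiding (hv : v ∈ G.componentAvoiding A u) : v ∉ A :=
  let ⟨p, hp⟩ := hv
  hp v p.end_mem_support

theorem mem_componentAvoiding_trans (hv : v ∈ G.componentAvoiding A u)
    (hw : w ∈ G.componentAvoiding A v) : w ∈ G.componentAvoiding A u := by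
  obtain ⟨p, hp⟩ := hv
  obtain ⟨q, hq⟩ := hw
  refine ⟨p.append q, fun z hz => ?_⟩
  rcases (Walk.mem_support_append_iff _ _).1 hz with h | h
  exacts [hp z h, hq z h]

theorem mem_componentAvoiding_symm (hv : v ∈ G.componentAvoiding A u) :
    u ∈ G.componentAvoiding A v := by
  obtain ⟨p, hp⟩ := hv
  exact ⟨p.reverse, fun z hz => hp z (by simpa using hz)⟩

theorem componentAvoiding_eq (hv : v ∈ G.componentAvoiding A u) :
    G.componentAvoiding A v = G.componentAvoiding A u :=
  Set.Subset.antisymm (fun _ h => mem_componentAvoiding_trans hv h)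
    fun _ h => mem_componentAvoiding_trans (mem_componentAvoiding_symm hv) h

theorem boundary_eq (hv : v ∈ G.componentAvoiding A u) : G.boundary A v = G.boundary A u := by
  simp only [boundary, componentAvoiding_eq hv]

theorem componentAvoiding_anti (h : A ⊆ B) : G.componentAvoiding B u ⊆ G.componentAvoiding A u :=
  fun _ ⟨p, hp⟩ => ⟨p, fun z hz hzA => hp z hz (h hzA)⟩

theorem mem_boundary_anti (h : A ⊆ B) (hx : x ∈ G.boundary B u) (hxA : x ∈ A) :
    x ∈ G.boundary A u :=
  let ⟨_, w, hw, ha⟩ := hx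
  ⟨hxA, w, componentAvoiding_anti h hw, ha⟩

theorem mem_componentAvoiding_of_adj (hv : v ∈ G.componentAvoiding A u) (ha : G.Adj v w)
    (hw : w ∉ A) : w ∈ G.componentAvoiding A u :=
  mem_componentAvoiding_trans hv ⟨ha.toWalk, by
    simpa using ⟨notMem_of_mem_componentAvoiding hv, hw⟩⟩

theorem connectedIn_componentAvoiding : G.ConnectedIn (G.componentAvoiding A u) := by
  intro a ha b hb
  classical
  obtain ⟨p, hp⟩ := mem_componentAvoiding_trans (mem_componentAvoiding_symm ha) hb
  exact ⟨p, fun z hz => mem_componentAvoiding_trans ha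
    ⟨p.takeUntil z hz, fun y hy => hp y (p.support_takeUntil_subset_support hz hy)⟩⟩

theorem exists_mem_boundary (p : G.Walk u v) (hu : u ∉ A) (hv : v ∈ A) :
    ∃ x ∈ p.support, x ∈ G.boundary A u := by
  induction p with
  | nil => exact absurd hv hu
  | cons h q ih =>
    rename_i a b c
    by_cases hb : b ∈ A
    · exact ⟨b, by simp, hb, a, self_mem_componentAvoiding hu, h.symm⟩
    · obtain ⟨x, hx, hxb⟩ := ih hb hv
      rw [boundary_eq (mem_componentAvoiding_of_adj (self_mem_componentAvoiding hu) h hb)] at hxb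
      exact ⟨x, by simp [hx], hxb⟩

end Components

/-! ### Subdivided cliques from connected sets, and dispersed sets. -/

theorem ConnectedIn.exists_isPath {G : SimpleGraph V} {C : Set V} (hC : G.ConnectedIn C) {x y : V}
    (hx : x ∉ C) (hy : y ∉ C) (hxy : x ≠ y) (hxC : ∃ a ∈ C, G.Adj x a) (hyC : ∃ a ∈ C, G.Adj y a) :
    ∃ p : G.Walk x y, p.IsPath ∧ (∀ z ∈ p.support, z = x ∨ z = y ∨ z ∈ C) ∧
      ∃ z ∈ p.support, z ∈ C := by
  classical
  obtain ⟨a, ha, hxa⟩ := hxC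
  obtain ⟨c, hc, hyc⟩ := hyC
  obtain ⟨w, hw⟩ := hC a ha c hc
  have hw' : ∀ z ∈ w.bypass.support, z ∈ C := fun z hz => hw z (w.support_bypass_subset_support hz)
  refine ⟨Walk.cons hxa (w.bypass.concat hyc.symm), ?_, ?_, a, by simp, ha⟩
  · rw [Walk.cons_isPath_iff, Walk.concat_isPath_iff]
    refine ⟨⟨w.bypass_isPath, fun h => hy (hw' _ h)⟩, ?_⟩
    rw [Walk.support_concat, List.mem_append, List.mem_singleton]
    rintro (h | h)
    exacts [hx (hw' _ h), hxy h]
  · intro z hz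
    rw [Walk.support_cons, List.mem_cons, Walk.support_concat, List.mem_append,
      List.mem_singleton] at hz
    rcases hz with h | h | h
    exacts [Or.inl h, Or.inr (Or.inr (hw' _ h)), Or.inr (Or.inl h)]

/-- Vertices `b i` and disjoint connected sets `C n` such that `b i` has neighbours in all `C n` with
`i ≤ n` give rise to a subdivided infinite clique. -/
theorem exists_isSubdividedInfiniteClique {G : SimpleGraph V} {b : ℕ → V} {C : ℕ → Set V}
    (hb : Function.Injective b) (hC : ∀ n, G.ConnectedIn (C n))
    (hdisj : ∀ m n, m ≠ n → Disjoint (C m) (C n)) (hbC : ∀ i n, b i ∉ C n)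
    (hadj : ∀ i n, i ≤ n → ∃ a ∈ C n, G.Adj (b i) a) :
    ∃ K : G.Subgraph, IsSubdividedInfiniteClique G K ∧
      ∀ j, 0 < j → ∃ z ∈ K.verts, z ∈ C (Nat.pair 0 j) := by
  have key : ∀ i j : ℕ, ∃ p : G.Walk (b i) (b j), i < j → p.IsPath ∧
      (∀ z ∈ p.support, z = b i ∨ z = b j ∨ z ∈ C (Nat.pair i j)) ∧
      ∃ z ∈ p.support, z ∈ C (Nat.pair i j) := by
    intro i j
    by_cases hij : i = j
    · subst hij
      exact ⟨Walk.nil, fun h => absurd h (lt_irrefl _)⟩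
    -- Pairing gives every path its own connected set, with index at least `i` and `j`, so that both
    -- ends have neighbours in it.
    · obtain ⟨p, hp⟩ := (hC (Nat.pair i j)).exists_isPath (hbC i _) (hbC j _)
        (fun h => hij (hb h)) (hadj i _ (Nat.left_le_pair i j)) (hadj j _ (Nat.right_le_pair i j))
      exact ⟨p, fun _ => hp⟩
  choose P hP using key
  refine ⟨_, ⟨b, P, ⟨hb, fun i j hij => (hP i j hij).1, ?_, ?_⟩, rfl⟩, ?_⟩
  · intro i j m hij hm
    rcases (hP i j hij).2.1 _ hm with h | h | h
    exacts [Or.inl (hb h), Or.inr (hb h), absurd h (hbC _ _)]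
  · intro i j k l hij hkl hne v hv hv'
    rcases (hP i j hij).2.1 _ hv with h | h | h
    · exact ⟨i, h⟩
    · exact ⟨j, h⟩
    rcases (hP k l hkl).2.1 _ hv' with h' | h' | h'
    · exact ⟨k, h'⟩
    · exact ⟨l, h'⟩
    · refine absurd h' (Set.disjoint_left.1 (hdisj _ _ fun he => hne ?_) h)
      exact Prod.ext_iff.2 (Nat.pair_eq_pair.1 he)
  · intro j hj
    obtain ⟨z, hz, hzC⟩ := (hP 0 j hj).2.2
    refine ⟨z, ?_, hzC⟩
    simp only [Subgraph.verts_iSup, Set.mem_iUnion, Walk.mem_verts_toSubgraph]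
    exact ⟨0, j, hj, hz⟩

/-- A finite separator misses one of the disjoint sets `C (Nat.pair 0 j)`, and inside that set a
vertex of `U` is joined to the clique. -/
theorem IsTKDispersed.false_of_connectedIn {G : SimpleGraph V} {U : Set V} (hU : G.IsTKDispersed U)
    {b : ℕ → V} {C : ℕ → Set V} (hb : Function.Injective b) (hC : ∀ n, G.ConnectedIn (C n))
    (hdisj : ∀ m n, m ≠ n → Disjoint (C m) (C n)) (hbC : ∀ i n, b i ∉ C n)
    (hadj : ∀ i n, i ≤ n → ∃ a ∈ C n, G.Adj (b i) a) (hUC : ∀ n, ∃ w ∈ U, w ∈ C n) : False := by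
  classical
  obtain ⟨K, hK, hKC⟩ := exists_isSubdividedInfiniteClique hb hC hdisj hbC hadj
  obtain ⟨S, hS, hsep⟩ := hU K hK
  have hfin : {j | ∃ s ∈ S, s ∈ C (Nat.pair 0 j)}.Finite := by
    have : {j | ∃ s ∈ S, s ∈ C (Nat.pair 0 j)} = ⋃ s ∈ S, {j | s ∈ C (Nat.pair 0 j)} := by
      ext j
      simp
    rw [this]
    refine hS.biUnion fun s _ => Set.Subsingleton.finite fun j hj k hk => ?_
    by_contra hne
    exact Set.disjoint_left.1 (hdisj _ _ fun he => hne (Nat.pair_eq_pair.1 he).2) hj hk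
  obtain ⟨j, hj⟩ := (hfin.union (Set.finite_singleton 0)).exists_notMem
  simp only [Set.mem_union, Set.mem_ofPred_eq, Set.mem_singleton_iff, not_or, not_exists,
    not_and] at hj
  obtain ⟨z, hz, hzC⟩ := hKC j (Nat.pos_of_ne_zero hj.2)
  obtain ⟨w, hw, hwC⟩ := hUC (Nat.pair 0 j)
  obtain ⟨p, hp⟩ := hC _ w hwC z hzC
  obtain ⟨s, hsS, hs⟩ := hsep w hw z hz p.bypass p.bypass_isPath
  exact hj.1 s hsS (hp s (p.support_bypass_subset_support hs))

theorem IsTKDispersed.union {G : SimpleGraph V} {U W : Set V} (hU : G.IsTKDispersed U)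
    (hW : G.IsTKDispersed W) : G.IsTKDispersed (U ∪ W) := by
  intro K hK
  obtain ⟨S, hS, hs⟩ := hU K hK
  obtain ⟨S', hS', hs'⟩ := hW K hK
  refine ⟨S ∪ S', hS.union hS', ?_⟩
  rintro a (ha | ha) c hc p hp
  · obtain ⟨s, h1, h2⟩ := hs a ha c hc p hp
    exact ⟨s, Or.inl h1, h2⟩
  · obtain ⟨s, h1, h2⟩ := hs' a ha c hc p hp
    exact ⟨s, Or.inr h1, h2⟩

/-- Monotonicity lets a single vertex represent, in `exists_develops`, all the sets that a component
meets. -/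
theorem exists_monotone_isTKDispersed {G : SimpleGraph V} {U : ℕ → Set V}
    (hU : ∀ n, G.IsTKDispersed (U n)) (hcov : ⋃ n, U n = Set.univ) :
    ∃ W : ℕ → Set V, Monotone W ∧ (∀ n, G.IsTKDispersed (W n)) ∧ ∀ v, ∃ n, v ∈ W n := by
  refine ⟨Set.accumulate U, Set.monotone_accumulate, fun n => ?_, fun v => ?_⟩
  · induction n with
    | zero => simpa using hU 0
    | succ n ih =>
      rw [Set.accumulate_succ]
      exact ih.union (hU _)
  · obtain ⟨n, hn⟩ := Set.mem_iUnion.1 (hcov.symm ▸ Set.mem_univ v : v ∈ ⋃ n, U n)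
    exact ⟨n, Set.subset_accumulate hn⟩

/-! ### Normal partial trees and their finite end extensions. -/

/-- A normal tree in `G` with root `r`, given by its tree order, such that every component of its
complement has only finitely many neighbours in the tree. -/
structure NormalPartialTree (G : SimpleGraph V) (r : V) where
  /-- The tree order; the vertices of the tree are those `x` with `le x x`. -/
  le : V → V → Prop
  refl_left : ∀ {x y}, le x y → le x x
  refl_right : ∀ {x y}, le x y → le y y
  trans : ∀ {x y z}, le x y → le y z → le x z
  antisymm : ∀ {x y}, le x y → le y x → x = y
  root_le : ∀ {x}, le x x → le r x
  root_mem : le r r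
  finite : ∀ x, {y | le y x}.Finite
  chain : ∀ {x y z}, le y x → le z x → le y z ∨ le z y
  pred : ∀ {x}, le x x → x ≠ r → ∃ p, p ≠ x ∧ le p x ∧ G.Adj p x ∧ ∀ y, le y x → y = x ∨ le y p
  comparable : ∀ {x y}, le x x → le y y → G.Adj x y → le x y ∨ le y x
  boundary_chain : ∀ {u x y}, ¬ le u u → x ∈ G.boundary {z | le z z} u →
    y ∈ G.boundary {z | le z z} u → le x y ∨ le y x
  boundary_finite : ∀ {u}, ¬ le u u → (G.boundary {z | le z z} u).Finite

namespace NormalPartialTree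

variable {G : SimpleGraph V} {r : V}

/-- The vertex set of the tree. -/
def carrier (T : NormalPartialTree G r) : Set V := {z | T.le z z}

theorem mem_carrier {T : NormalPartialTree G r} {x : V} : x ∈ T.carrier ↔ T.le x x := Iff.rfl

/-- The tree consisting of the root only. -/
def singleton (G : SimpleGraph V) (r : V) : NormalPartialTree G r where
  le x y := x = r ∧ y = r
  refl_left h := ⟨h.1, h.1⟩
  refl_right h := ⟨h.2, h.2⟩
  trans h h' := ⟨h.1, h'.2⟩
  antisymm h h' := h.1.trans h'.1.symm
  root_le h := ⟨rfl, h.1⟩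
  root_mem := ⟨rfl, rfl⟩
  finite _ := (Set.finite_singleton r).subset fun _ h => h.1
  chain h h' := Or.inl ⟨h.1, h'.1⟩
  pred h h' := absurd h.1 h'
  comparable h h' _ := Or.inl ⟨h.1, h'.1⟩
  boundary_chain _ h h' := Or.inl ⟨h.1.1, h'.1.1⟩
  boundary_finite _ := (Set.finite_singleton r).subset fun _ h => h.1.1

/-- `T'` is an end extension of `T`. -/
def EndExtends (T T' : NormalPartialTree G r) : Prop :=
  ∀ x y, T.le y y → (T'.le x y ↔ T.le x y)

theorem EndExtends.carrier_subset {T T' : NormalPartialTree G r} (h : EndExtends T T') :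
    T.carrier ⊆ T'.carrier := fun x hx => (h x x hx).2 hx

theorem EndExtends.trans {T T' T'' : NormalPartialTree G r} (h : EndExtends T T')
    (h' : EndExtends T' T'') : EndExtends T T'' :=
  fun x y hy => (h' x y (h.carrier_subset hy)).trans (h x y hy)

/-- A maximal vertex `x` of the boundary of a component, and a neighbour `w` of `x` in it: adding
`w` as a successor of `x` gives a larger tree. -/
theorem exists_insert (T : NormalPartialTree G r) {u x w : V}
    (hx : x ∈ G.boundary T.carrier u) (htop : ∀ y ∈ G.boundary T.carrier u, T.le y x)
    (hw : w ∈ G.componentAvoiding T.carrier u) (hadj : G.Adj x w) :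
    ∃ T' : NormalPartialTree G r, EndExtends T T' ∧ T'.carrier = insert w T.carrier ∧
      T'.le x w := by
  have hwT : ∀ {y}, T.le w y → False := fun h =>
    notMem_of_mem_componentAvoiding hw (T.refl_left h)
  have hwT' : ∀ {y}, T.le y w → False := fun h =>
    notMem_of_mem_componentAvoiding hw (T.refl_right h)
  have hxx : T.le x x := hx.1
  let le : V → V → Prop := fun a b => T.le a b ∨ (b = w ∧ (T.le a x ∨ a = w))
  have hww : le w w := Or.inr ⟨rfl, Or.inr rfl⟩
  have hle : ∀ a b, T.le b b → (le a b ↔ T.le a b) := by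
    intro a b hb
    refine ⟨?_, Or.inl⟩
    rintro (h | ⟨rfl, -⟩)
    exacts [h, (hwT hb).elim]
  have hcar : {z | le z z} = insert w T.carrier := by
    ext z
    rw [Set.mem_insert_iff, mem_carrier]
    constructor
    · rintro (h | ⟨rfl, -⟩)
      exacts [Or.inr h, Or.inl rfl]
    · rintro (rfl | h)
      exacts [hww, Or.inl h]
  have hsub : T.carrier ⊆ {z | le z z} := fun z hz => Or.inl hz
  -- A new component adjacent to `w` lies in the old component of `u`, so its old neighbours are all
  -- below `x`, hence below `w`.
  have hbw : ∀ {v}, w ∈ G.boundary {z | le z z} v → ¬ le v v →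
      G.boundary T.carrier v = G.boundary T.carrier u := by
    rintro v ⟨-, c, hc, hwc⟩ hv
    have h1 := componentAvoiding_anti hsub hc
    rw [← boundary_eq hw]
    refine (boundary_eq (mem_componentAvoiding_of_adj h1 hwc.symm ?_)).symm
    exact notMem_of_mem_componentAvoiding hw
  have hbd : ∀ {v y}, y ∈ G.boundary {z | le z z} v → y = w ∨ y ∈ G.boundary T.carrier v := by
    intro v y hy
    have h1 := hy.1
    rw [hcar] at h1
    exact h1.imp_right fun h => mem_boundary_anti hsub hy h
  have hnot : ∀ {v}, ¬ le v v → ¬ T.le v v := fun h h' => h (Or.inl h')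
  refine ⟨{ le := le, refl_left := ?_, refl_right := ?_, trans := ?_, antisymm := ?_,
            root_le := ?_, root_mem := Or.inl T.root_mem, finite := ?_, chain := ?_, pred := ?_,
            comparable := ?_, boundary_chain := ?_, boundary_finite := ?_ },
    hle, hcar, Or.inr ⟨rfl, Or.inl hxx⟩⟩
  · rintro a b (h | ⟨rfl, h | rfl⟩)
    exacts [Or.inl (T.refl_left h), Or.inl (T.refl_left h), hww]
  · rintro a b (h | ⟨rfl, -⟩)
    exacts [Or.inl (T.refl_right h), hww]
  · rintro a b c h (h' | ⟨rfl, h' | rfl⟩)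
    · exact Or.inl (T.trans ((hle a b (T.refl_left h')).1 h) h')
    · exact Or.inr ⟨rfl, Or.inl (T.trans ((hle a b (T.refl_left h')).1 h) h')⟩
    · exact h
  · rintro a b (h | ⟨rfl, h⟩) (h' | ⟨h1, h'⟩)
    · exact T.antisymm h h'
    · subst h1
      exact (hwT h).elim
    · exact (hwT h').elim
    · exact h1
  · intro a ha
    by_cases haw : a = w
    · exact Or.inr ⟨haw, Or.inl (T.root_le hxx)⟩
    · exact Or.inl (T.root_le (ha.resolve_right fun h => haw h.1))
  · intro a
    refine (((T.finite a).union (T.finite x)).union (Set.finite_singleton w)).subset ?_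
    rintro y (h | ⟨-, h | rfl⟩)
    exacts [Or.inl (Or.inl h), Or.inl (Or.inr h), Or.inr rfl]
  · rintro a b c (h | ⟨rfl, h | rfl⟩) (h' | ⟨h1, h' | rfl⟩)
    · exact (T.chain h h').imp Or.inl Or.inl
    · exact (hwT' (h1 ▸ h)).elim
    · exact (hwT' (h1 ▸ h)).elim
    · exact (hwT' h').elim
    · exact (T.chain h h').imp Or.inl Or.inl
    · exact Or.inl (Or.inr ⟨rfl, Or.inl h⟩)
    · exact (hwT' h').elim
    · exact Or.inr (Or.inr ⟨rfl, Or.inl h'⟩)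
    · exact Or.inl hww
  · intro a ha har
    by_cases haw : a = w
    · subst haw
      refine ⟨x, hadj.ne, Or.inr ⟨rfl, Or.inl hxx⟩, hadj, ?_⟩
      rintro y (h | ⟨-, h | h⟩)
      exacts [(hwT' h).elim, Or.inr (Or.inl h), Or.inl h]
    · have haT : T.le a a := ha.resolve_right fun h => haw h.1
      obtain ⟨p, h1, h2, h3, h4⟩ := T.pred haT har
      exact ⟨p, h1, Or.inl h2, h3, fun y hy => (h4 y ((hle y a haT).1 hy)).imp_right Or.inl⟩
  · have key : ∀ {b}, T.le b b → G.Adj b w → le b w := fun {b} hb hab =>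
      Or.inr ⟨rfl, Or.inl (htop b ⟨hb, w, hw, hab⟩)⟩
    intro a b ha hb hab
    by_cases haw : a = w
    · subst haw
      exact Or.inr (key (hb.resolve_right fun h => hab.ne h.1.symm) hab.symm)
    · have haT : T.le a a := ha.resolve_right fun h => haw h.1
      by_cases hbw : b = w
      · subst hbw
        exact Or.inl (key haT hab)
      · exact (T.comparable haT (hb.resolve_right fun h => hbw h.1) hab).imp Or.inl Or.inl
  · intro v a b hv ha hb
    have key : ∀ {c}, w ∈ G.boundary {z | le z z} v → c ∈ G.boundary T.carrier v → le c w := by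
      intro c h h'
      rw [hbw h hv] at h'
      exact Or.inr ⟨rfl, Or.inl (htop c h')⟩
    rcases hbd ha with rfl | ha'
    · rcases hbd hb with rfl | hb'
      · exact Or.inl hww
      · exact Or.inr (key ha hb')
    · rcases hbd hb with rfl | hb'
      · exact Or.inl (key hb ha')
      · exact (T.boundary_chain (hnot hv) ha' hb').imp Or.inl Or.inl
  · intro v hv
    exact ((Set.finite_singleton w).union (T.boundary_finite (hnot hv))).subset fun y hy => hbd hy

/-- Each vertex of the path, once inserted, is the top neighbour of the component containing the
rest of the path, so the next one can be attached to it. -/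
theorem exists_insert_path {w v : V} (p : G.Walk w v) (hp : p.IsPath) (T : NormalPartialTree G r)
    (hpT : ∀ z ∈ p.support, z ∉ T.carrier) {x : V} (hx : x ∈ G.boundary T.carrier v)
    (htop : ∀ y ∈ G.boundary T.carrier v, T.le y x) (hadj : G.Adj x w) :
    ∃ T' : NormalPartialTree G r, EndExtends T T' ∧
      T'.carrier = T.carrier ∪ {z | z ∈ p.support} := by
  induction p generalizing T x with
  | nil =>
    obtain ⟨T', h1, h2, -⟩ := T.exists_insert hx htop
      (self_mem_componentAvoiding (hpT _ (by simp))) hadj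
    refine ⟨T', h1, h2.trans ?_⟩
    ext z
    simp [or_comm]
  | cons h q ih =>
    rename_i w w' v
    rw [Walk.cons_isPath_iff] at hp
    have hw : w ∈ G.componentAvoiding T.carrier v :=
      mem_componentAvoiding_symm ⟨Walk.cons h q, hpT⟩
    obtain ⟨T₁, h1, h2, h3⟩ := T.exists_insert hx htop hw hadj
    have hq : ∀ z ∈ q.support, z ∉ T₁.carrier := by
      intro z hz
      rw [h2, Set.mem_insert_iff, not_or]
      exact ⟨fun h => hp.2 (h ▸ hz), hpT z (by simp [hz])⟩
    have hwT : w ∈ T₁.carrier := h2 ▸ Set.mem_insert _ _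
    have hwtop : ∀ y ∈ G.boundary T₁.carrier v, T₁.le y w := by
      intro y hy
      have hyT := hy.1
      rw [h2, Set.mem_insert_iff] at hyT
      rcases hyT with rfl | hyT
      · exact hwT
      · exact T₁.trans ((h1 y x hx.1).2 (htop y (mem_boundary_anti h1.carrier_subset hy hyT))) h3
    obtain ⟨T', h4, h5⟩ := ih hp.1 T₁ hq (x := w)
      ⟨hwT, w', mem_componentAvoiding_symm ⟨q, hq⟩, h⟩ hwtop h
    refine ⟨T', h1.trans h4, ?_⟩
    rw [h5, h2]
    ext z
    simp [or_assoc, or_left_comm]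

theorem exists_top (T : NormalPartialTree G r) (hG : G.Connected) {u : V} (hu : u ∉ T.carrier) :
    ∃ x ∈ G.boundary T.carrier u, ∀ y ∈ G.boundary T.carrier u, T.le y x := by
  obtain ⟨p⟩ := hG.preconnected u r
  obtain ⟨x₀, -, hx₀⟩ := exists_mem_boundary p hu T.root_mem
  have hfin := T.boundary_finite hu
  obtain ⟨x, hx, hmax⟩ := hfin.exists_maximalFor (fun x => {y | T.le y x}.ncard) _ ⟨x₀, hx₀⟩
  refine ⟨x, hx, fun y hy => (T.boundary_chain hu hy hx).elim id fun hxy => ?_⟩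
  have hsub : {z | T.le z x} ⊆ {z | T.le z y} := fun z hz => T.trans hz hxy
  have := Set.eq_of_subset_of_ncard_le hsub
    (hmax hy (Set.ncard_le_ncard hsub (T.finite y))) (T.finite y)
  have hyy : y ∈ {z | T.le z y} := hy.1
  rw [← this] at hyy
  exact hyy

/-- The vertices of `Z` are treated one by one, each being joined to the current tree by a path from
the top neighbour of its component. -/
theorem exists_cover (T : NormalPartialTree G r) (hG : G.Connected) {u : V} {Z : Set V}
    (hZ : Z.Finite) (hZu : Z ⊆ G.componentAvoiding T.carrier u) :
    ∃ (T' : NormalPartialTree G r) (F : Set V), EndExtends T T' ∧ T'.carrier = T.carrier ∪ F ∧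
      F ⊆ G.componentAvoiding T.carrier u ∧ G.ConnectedIn F ∧ Z ⊆ F := by
  classical
  induction Z, hZ using Set.Finite.induction_on with
  | empty =>
    exact ⟨T, ∅, fun _ _ _ => Iff.rfl, by simp, by simp, fun a ha => ha.elim, le_rfl⟩
  | insert _ _ ih =>
    rename_i v Z _ _
    obtain ⟨T', F, h1, h2, h3, h4, h5⟩ := ih fun z hz => hZu (Set.mem_insert_of_mem _ hz)
    have hvu := hZu (Set.mem_insert v Z)
    by_cases hv : v ∈ T'.carrier
    · have hvF : v ∈ F := by
        rw [h2] at hv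
        exact hv.resolve_left (notMem_of_mem_componentAvoiding hvu)
      exact ⟨T', F, h1, h2, h3, h4, Set.insert_subset hvF h5⟩
    obtain ⟨x, hx, htop⟩ := T'.exists_top hG hv
    obtain ⟨hxT, w, ⟨p, hp⟩, hxw⟩ := id hx
    have hq : ∀ z ∈ p.reverse.bypass.support, z ∉ T'.carrier := fun z hz =>
      hp z (by simpa using p.reverse.support_bypass_subset_support hz)
    generalize p.reverse.bypass = q, p.reverse.bypass_isPath = hqp at hq
    obtain ⟨T'', h6, h7⟩ := exists_insert_path q hqp T' hq hx htop hxw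
    have hqv : ∀ z ∈ q.support, z ∈ G.componentAvoiding T.carrier u := fun z hz =>
      mem_componentAvoiding_trans hvu (componentAvoiding_anti h1.carrier_subset
        ⟨(q.dropUntil z hz).reverse, fun y hy => hq y
          (q.support_dropUntil_subset_support hz (by simpa using hy))⟩)
    refine ⟨T'', F ∪ {z | z ∈ q.support}, h1.trans h6, by rw [h7, h2, Set.union_assoc],
      Set.union_subset h3 hqv, ?_, Set.insert_subset (Or.inr q.end_mem_support)
        (h5.trans Set.subset_union_left)⟩
    -- A walk from `v` to `F` inside the component of `G - T` meets a neighbour `y` of the current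
    -- component of `v`, with `y` in `T'` but not in `T`. As `y` is below `x` and `T` is closed
    -- downwards, `x` is not in `T` either.
    have hxF : ∀ a ∈ F, x ∈ F := by
      intro a ha
      obtain ⟨s, hs⟩ := connectedIn_componentAvoiding v hvu a (h3 ha)
      obtain ⟨y, hys, hy⟩ := exists_mem_boundary s hv (by rw [h2]; exact Or.inr ha)
      have hyT : y ∉ T.carrier := notMem_of_mem_componentAvoiding (hs y hys)
      rw [h2] at hxT
      refine hxT.resolve_left fun hxT => hyT ?_
      exact T.refl_left ((h1 y x hxT).1 (htop y hy))
    have hqc : ∀ z (hz : z ∈ q.support), ∃ s : G.Walk w z, ∀ y ∈ s.support, y ∈ q.support :=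
      fun z hz => ⟨q.takeUntil z hz, fun y hy => q.support_takeUntil_subset_support hz hy⟩
    have hFq : ∀ a ∈ F, ∀ z ∈ q.support,
        ∃ s : G.Walk a z, ∀ y ∈ s.support, y ∈ F ∪ {z | z ∈ q.support} := by
      intro a ha z hz
      obtain ⟨s, hs⟩ := h4 a ha x (hxF a ha)
      obtain ⟨t, ht⟩ := hqc z hz
      refine ⟨s.append (Walk.cons hxw t), fun y hy => ?_⟩
      rw [Walk.mem_support_append_iff, Walk.support_cons, List.mem_cons] at hy
      rcases hy with hy | rfl | hy
      exacts [Or.inl (hs y hy), Or.inl (hxF a ha), Or.inr (ht y hy)]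
    rintro a (ha | ha) b (hb | hb)
    · obtain ⟨s, hs⟩ := h4 a ha b hb
      exact ⟨s, fun z hz => Or.inl (hs z hz)⟩
    · exact hFq a ha b hb
    · obtain ⟨s, hs⟩ := hFq b hb a ha
      exact ⟨s.reverse, fun y hy => hs y (by simpa using hy)⟩
    · obtain ⟨s, hs⟩ := hqc a ha
      obtain ⟨t, ht⟩ := hqc b hb
      refine ⟨s.reverse.append t, fun y hy => Or.inr ?_⟩
      rw [Walk.mem_support_append_iff, Walk.support_reverse, List.mem_reverse] at hy
      exact hy.elim (hs y) (ht y)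

/-! ### The order for Zorn's lemma: limits and proper extensions. -/

/-- `T'` is an end extension of `T` such that every component of `G - T` meeting `T'` contains a
connected part of `T'` to which all its neighbours in `T` are attached and which meets those `U k`
that the component meets. -/
structure Develops (U : ℕ → Set V) (T T' : NormalPartialTree G r) : Prop where
  endExtends : EndExtends T T'
  develop : ∀ u, u ∉ T.carrier → (∃ w ∈ G.componentAvoiding T.carrier u, w ∈ T'.carrier) →
    ∃ C : Set V, C ⊆ T'.carrier ∧ C ⊆ G.componentAvoiding T.carrier u ∧ G.ConnectedIn C ∧
      (∀ x ∈ G.boundary T.carrier u, ∃ a ∈ C, G.Adj x a) ∧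
      ∀ k, (∃ w ∈ U k, w ∈ G.componentAvoiding T.carrier u) → ∃ w ∈ U k, w ∈ C

variable {U : ℕ → Set V}

theorem Develops.refl (T : NormalPartialTree G r) : Develops U T T :=
  ⟨fun _ _ _ => Iff.rfl, fun _ _ ⟨_, hw, hwT⟩ => absurd hwT (notMem_of_mem_componentAvoiding hw)⟩

theorem Develops.trans {T T' T'' : NormalPartialTree G r} (h : Develops U T T')
    (h' : Develops U T' T'') : Develops U T T'' := by
  refine ⟨h.endExtends.trans h'.endExtends, fun u hu hw => ?_⟩
  by_cases hm : ∃ w ∈ G.componentAvoiding T.carrier u, w ∈ T'.carrier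
  · obtain ⟨C, h1, h2⟩ := h.develop u hu hm
    exact ⟨C, h1.trans h'.endExtends.carrier_subset, h2⟩
  -- A component that `T'` misses is still a component of `G - T'`, with the same neighbours.
  · push Not at hm
    have hsub := h.endExtends.carrier_subset
    have he : G.componentAvoiding T'.carrier u = G.componentAvoiding T.carrier u := by
      refine Set.Subset.antisymm (componentAvoiding_anti hsub) fun v hv => ?_
      obtain ⟨p, hp⟩ := connectedIn_componentAvoiding u (self_mem_componentAvoiding hu) v hv
      exact ⟨p, fun z hz => hm z (hp z hz)⟩
    obtain ⟨C, h1, h2, h3, h4, h5⟩ :=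
      h'.develop u (hm u (self_mem_componentAvoiding hu)) (by rwa [he])
    rw [he] at h2 h5
    refine ⟨C, h1, h2, h3, fun x hx => h4 x ⟨hsub hx.1, ?_⟩, h5⟩
    rw [he]
    exact hx.2

section Chain

variable {c : Set (NormalPartialTree G r)}

theorem develops_or_develops (hc : IsChain (Develops U) c) {T T' : NormalPartialTree G r}
    (hT : T ∈ c) (hT' : T' ∈ c) : Develops U T T' ∨ Develops U T' T := by
  by_cases h : T = T'
  · exact Or.inl (h ▸ Develops.refl T)
  · exact hc hT hT' h

theorem le_of_isChain (hc : IsChain (Develops U) c) {T T' : NormalPartialTree G r}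
    (hT : T ∈ c) (hT' : T' ∈ c) {x y : V} (hxy : T'.le x y) (hy : T.le y y) : T.le x y := by
  rcases develops_or_develops hc hT hT' with h | h
  · exact (h.endExtends x y hy).1 hxy
  · exact (h.endExtends x y (T'.refl_right hxy)).2 hxy

/-- If the component of `u` had infinitely many neighbours, no tree of the chain would contain them
all. This gives an increasing sequence of trees, each step gaining a neighbour `y` and a connected
piece `C` of the component of `u` at that stage. -/
theorem boundary_finite_of_isChain (hU : ∀ n, G.IsTKDispersed (U n)) (hcov : ∀ v, ∃ n, v ∈ U n)
    (hc : IsChain (Develops U) c) (hne : c.Nonempty) {A : Set V}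
    (hA : ∀ x, x ∈ A ↔ ∃ T ∈ c, x ∈ T.carrier) {u : V} (hu : u ∉ A) :
    (G.boundary A u).Finite := by
  have hsub : ∀ T ∈ c, T.carrier ⊆ A := fun T hT x hx => (hA x).2 ⟨T, hT, hx⟩
  have huT : ∀ T ∈ c, u ∉ T.carrier := fun T hT h => hu (hsub T hT h)
  by_contra hinf
  have step : ∀ T : c, ∃ T' : c, ∃ y ∈ G.boundary A u, Develops U T.1 T'.1 ∧ y ∉ T.1.carrier ∧
      y ∈ T'.1.carrier := by
    rintro ⟨T, hT⟩
    obtain ⟨y, hy, hyT⟩ : ∃ y ∈ G.boundary A u, y ∉ T.carrier := by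
      by_contra! hcon
      exact hinf ((T.boundary_finite (huT T hT)).subset fun y hy =>
        mem_boundary_anti (hsub T hT) hy (hcon y hy))
    obtain ⟨T', hT', hyT'⟩ := (hA y).1 hy.1
    refine ⟨⟨T', hT'⟩, y, hy, (develops_or_develops hc hT hT').resolve_right fun h => ?_, hyT, hyT'⟩
    exact hyT (h.endExtends.carrier_subset hyT')
  choose next y hyb hdev hyn hyc using step
  obtain ⟨T₀, hT₀⟩ := hne
  let t : ℕ → c := fun n => next^[n] ⟨T₀, hT₀⟩
  have ht : ∀ n, t (n + 1) = next (t n) := fun n => Function.iterate_succ_apply' _ _ _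
  have hmono : Monotone fun n => (t n).1.carrier := by
    refine monotone_nat_of_le_succ fun n => ?_
    rw [ht]
    exact (hdev (t n)).endExtends.carrier_subset
  have hyc' : ∀ m n, m < n → y (t m) ∈ (t n).1.carrier := fun m n hmn =>
    hmono (Nat.succ_le_of_lt hmn) (by simpa only [ht] using hyc (t m))
  have hyn' : ∀ m n, n ≤ m → y (t m) ∉ (t n).1.carrier := fun m n hmn h =>
    hyn (t m) (hmono hmn h)
  have hC : ∀ n, ∃ C : Set V, C ⊆ (t (n + 1)).1.carrier ∧
      C ⊆ G.componentAvoiding (t n).1.carrier u ∧ G.ConnectedIn C ∧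
      (∀ x ∈ G.boundary (t n).1.carrier u, ∃ a ∈ C, G.Adj x a) ∧
      ∀ k, (∃ w ∈ U k, w ∈ G.componentAvoiding (t n).1.carrier u) → ∃ w ∈ U k, w ∈ C := by
    intro n
    rw [ht]
    refine (hdev (t n)).develop u (huT _ (t n).2) ⟨y (t n), ?_, hyc (t n)⟩
    obtain ⟨-, w, hw, hyw⟩ := hyb (t n)
    exact mem_componentAvoiding_of_adj (componentAvoiding_anti (hsub _ (t n).2) hw) hyw.symm
      (hyn (t n))
  choose C hCt hCu hCc hCa hCU using hC
  have hCn : ∀ m n, m < n → ∀ z ∈ C m, z ∈ (t n).1.carrier := fun m n hmn z hz =>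
    hmono (Nat.succ_le_of_lt hmn) (hCt m hz)
  have hCn' : ∀ n, ∀ z ∈ C n, z ∉ (t n).1.carrier := fun n z hz =>
    notMem_of_mem_componentAvoiding (hCu n hz)
  obtain ⟨k, hk⟩ := hcov u
  -- Both `y (t m)` and `C m` appear between stages `m` and `m + 1`. Taking branch vertices from
  -- even stages and connected sets from odd ones keeps them disjoint, and `i ≤ n` gives `2 * i < 2
  -- * n + 1`. Each piece meets `U k` because `u` itself remains in the component.
  refine (hU k).false_of_connectedIn (b := fun i => y (t (2 * i))) (C := fun n => C (2 * n + 1))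
    ?_ (fun n => hCc _) ?_ ?_ ?_ fun n => hCU _ k ⟨u, hk, self_mem_componentAvoiding
      (huT _ (t _).2)⟩
  · intro i j hij
    change y (t (2 * i)) = y (t (2 * j)) at hij
    by_contra hne
    rcases Nat.lt_or_gt_of_ne hne with h | h
    · exact hyn' (2 * j) (2 * j) le_rfl (hij ▸ hyc' (2 * i) (2 * j) (by omega))
    · exact hyn' (2 * i) (2 * i) le_rfl (hij ▸ hyc' (2 * j) (2 * i) (by omega))
  · intro m n hmn
    rw [Set.disjoint_left]
    intro z hz hz'
    rcases Nat.lt_or_gt_of_ne hmn with h | h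
    · exact hCn' _ z hz' (hCn _ _ (by omega) z hz)
    · exact hCn' _ z hz (hCn _ _ (by omega) z hz')
  · intro i n h
    rcases Nat.lt_or_ge (2 * i) (2 * n + 1) with h' | h'
    · exact hCn' _ _ h (hyc' _ _ h')
    · exact hyn' (2 * i) (2 * i) le_rfl (hCn _ _ (by omega) _ h)
  · intro i n hin
    exact hCa _ _ (mem_boundary_anti (hsub _ (t _).2) (hyb _) (hyc' _ _ (by omega)))

/-- The bound is the union of the orders in the chain. Every tree axiom involves only vertices of
one member, except finiteness of boundaries. -/
theorem exists_upper_bound (hU : ∀ n, G.IsTKDispersed (U n)) (hcov : ∀ v, ∃ n, v ∈ U n)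
    (hc : IsChain (Develops U) c) (hne : c.Nonempty) :
    ∃ T' : NormalPartialTree G r, ∀ T ∈ c, Develops U T T' := by
  let le : V → V → Prop := fun x y => ∃ T ∈ c, T.le x y
  have hloc : ∀ {x y T}, T ∈ c → le x y → T.le y y → T.le x y := by
    rintro x y T hT ⟨T', hT', hxy⟩ hy
    exact le_of_isChain hc hT hT' hxy hy
  have hboth : ∀ {x y}, le x x → le y y → ∃ T ∈ c, T.le x x ∧ T.le y y := by
    rintro x y ⟨T, hT, hx⟩ ⟨T', hT', hy⟩
    rcases develops_or_develops hc hT hT' with h | h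
    · exact ⟨T', hT', h.endExtends.carrier_subset hx, hy⟩
    · exact ⟨T, hT, hx, h.endExtends.carrier_subset hy⟩
  have hsub : ∀ T ∈ c, T.carrier ⊆ {z | le z z} := fun T hT z hz => ⟨T, hT, hz⟩
  let T' : NormalPartialTree G r :=
    { le := le
      refl_left := fun ⟨T, hT, h⟩ => ⟨T, hT, T.refl_left h⟩
      refl_right := fun ⟨T, hT, h⟩ => ⟨T, hT, T.refl_right h⟩
      trans := fun h ⟨T, hT, h'⟩ => ⟨T, hT, T.trans (hloc hT h (T.refl_left h')) h'⟩
      antisymm := fun ⟨T, hT, h⟩ h' => T.antisymm h (hloc hT h' (T.refl_left h))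
      root_le := fun ⟨T, hT, h⟩ => ⟨T, hT, T.root_le h⟩
      root_mem := hne.elim fun T hT => ⟨T, hT, T.root_mem⟩
      finite := by
        intro x
        by_cases hx : le x x
        · obtain ⟨T, hT, hx⟩ := hx
          exact (T.finite x).subset fun y hy => hloc hT hy hx
        · refine Set.finite_empty.subset ?_
          rintro y ⟨T, hT, hy⟩
          exact hx ⟨T, hT, T.refl_right hy⟩
      chain := fun ⟨T, hT, h⟩ h' =>
        (T.chain h (hloc hT h' (T.refl_right h))).imp (fun h => ⟨T, hT, h⟩) fun h => ⟨T, hT, h⟩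
      pred := by
        rintro x ⟨T, hT, hx⟩ hxr
        obtain ⟨p, h1, h2, h3, h4⟩ := T.pred hx hxr
        exact ⟨p, h1, ⟨T, hT, h2⟩, h3, fun y hy => (h4 y (hloc hT hy hx)).imp_right
          fun h => ⟨T, hT, h⟩⟩
      comparable := by
        intro x y hx hy hxy
        obtain ⟨T, hT, hx, hy⟩ := hboth hx hy
        exact (T.comparable hx hy hxy).imp (fun h => ⟨T, hT, h⟩) fun h => ⟨T, hT, h⟩
      boundary_chain := by
        intro u x y hu hx hy
        obtain ⟨T, hT, hxT, hyT⟩ := hboth hx.1 hy.1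
        exact (T.boundary_chain (fun h => hu ⟨T, hT, h⟩) (mem_boundary_anti (hsub T hT) hx hxT)
          (mem_boundary_anti (hsub T hT) hy hyT)).imp (fun h => ⟨T, hT, h⟩) fun h => ⟨T, hT, h⟩
      boundary_finite := fun hu =>
        boundary_finite_of_isChain hU hcov hc hne (fun x => Iff.rfl) hu }
  refine ⟨T', fun T hT => ⟨fun x y hy => ⟨fun h => hloc hT h hy, fun h => ⟨T, hT, h⟩⟩, ?_⟩⟩
  rintro u hu ⟨w, hw, T₁, hT₁, hwT₁⟩
  have hwT := notMem_of_mem_componentAvoiding hw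
  have hdev : Develops U T T₁ := (develops_or_develops hc hT hT₁).resolve_right fun h =>
    hwT (h.endExtends.carrier_subset hwT₁)
  obtain ⟨C, h1, h2⟩ := hdev.develop u hu ⟨w, hw, hwT₁⟩
  exact ⟨C, h1.trans (hsub T₁ hT₁), h2⟩

end Chain

theorem exists_develops (hG : G.Connected) (hmono : Monotone U) (hcov : ∀ v, ∃ n, v ∈ U n)
    (T : NormalPartialTree G r) {u : V} (hu : u ∉ T.carrier) :
    ∃ T', Develops U T T' ∧ ∃ w ∈ T'.carrier, w ∉ T.carrier := by
  classical
  have hex : ∃ k, ∃ w ∈ U k, w ∈ G.componentAvoiding T.carrier u :=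
    let ⟨k, hk⟩ := hcov u
    ⟨k, u, hk, self_mem_componentAvoiding hu⟩
  -- With the least index chosen, `w₀` lies in every `U k` that the component meets.
  obtain ⟨w₀, hw₀U, hw₀⟩ := Nat.find_spec hex
  have hnb : ∀ x : G.boundary T.carrier u, ∃ w ∈ G.componentAvoiding T.carrier u, G.Adj x.1 w :=
    fun x => x.2.2
  choose nb hnb hnadj using hnb
  have : Finite (G.boundary T.carrier u) := T.boundary_finite hu
  obtain ⟨T', F, h1, h2, h3, h4, h5⟩ := T.exists_cover hG (u := u)
    (Z := insert w₀ (Set.range nb)) ((Set.finite_range nb).insert w₀)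
    (Set.insert_subset hw₀ (Set.range_subset_iff.2 hnb))
  have hw₀F : w₀ ∈ F := h5 (Set.mem_insert _ _)
  refine ⟨T', ⟨h1, ?_⟩, w₀, by rw [h2]; exact Or.inr hw₀F, notMem_of_mem_componentAvoiding hw₀⟩
  rintro v hv ⟨w, hwv, hwT'⟩
  rw [h2] at hwT'
  have hwu := h3 (hwT'.resolve_left (notMem_of_mem_componentAvoiding hwv))
  have hvu := mem_componentAvoiding_trans hwu (mem_componentAvoiding_symm hwv)
  rw [boundary_eq hvu, componentAvoiding_eq hvu]
  refine ⟨F, by rw [h2]; exact Set.subset_union_right, h3, h4, fun x hx => ?_, fun k hk => ?_⟩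
  · exact ⟨nb ⟨x, hx⟩, h5 (Or.inr ⟨_, rfl⟩), hnadj ⟨x, hx⟩⟩
  · exact ⟨w₀, hmono (Nat.find_min' hex hk) hw₀U, hw₀F⟩

theorem exists_carrier_eq_univ (hG : G.Connected) (r : V) (hmono : Monotone U)
    (hU : ∀ n, G.IsTKDispersed (U n)) (hcov : ∀ v, ∃ n, v ∈ U n) :
    ∃ T : NormalPartialTree G r, ∀ v, T.le v v := by
  obtain ⟨T, hT⟩ := exists_maximal_of_chains_bounded (r := Develops (G := G) (r := r) U)
    (fun c hc => by
      rcases c.eq_empty_or_nonempty with rfl | hne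
      · exact ⟨singleton G r, fun a ha => ha.elim⟩
      · exact exists_upper_bound hU hcov hc hne) Develops.trans
  refine ⟨T, fun v => ?_⟩
  by_contra hv
  obtain ⟨T', h, w, hw, hwT⟩ := exists_develops hG hmono hcov T hv
  exact hwT ((hT T' h).endExtends.carrier_subset hw)

/-! ### From a tree order on all vertices to a normal spanning tree. -/

/-- `x` is the predecessor of `y` in the tree order. -/
def IsPred (T : NormalPartialTree G r) (x y : V) : Prop :=
  x ≠ y ∧ T.le x y ∧ G.Adj x y ∧ ∀ z, T.le z y → z = y ∨ T.le z x

theorem IsPred.unique {T : NormalPartialTree G r} {x y z : V} (hx : T.IsPred x z)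
    (hy : T.IsPred y z) : x = y :=
  T.antisymm ((hy.2.2.2 x hx.2.1).resolve_left hx.1) ((hx.2.2.2 y hy.2.1).resolve_left hy.1)

/-- The tree as a graph. -/
def graph (T : NormalPartialTree G r) : SimpleGraph V where
  Adj x y := T.IsPred x y ∨ T.IsPred y x
  symm := ⟨fun _ _ h => h.symm⟩
  loopless := ⟨fun _ h => h.elim (fun h => h.1 rfl) fun h => h.1 rfl⟩

theorem IsPred.ncard_lt {T : NormalPartialTree G r} {x y : V} (h : T.IsPred x y) :
    {z | T.le z x}.ncard < {z | T.le z y}.ncard := by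
  refine Set.ncard_lt_ncard ⟨fun z hz => T.trans hz h.2.1, fun hs => h.1 ?_⟩ (T.finite y)
  exact T.antisymm h.2.1 (hs (T.refl_right h.2.1))

theorem exists_isPath (T : NormalPartialTree G r) (v : V) (hv : T.le v v) :
    ∃ p : T.graph.Walk r v, p.IsPath ∧ ∀ z, z ∈ p.support ↔ T.le z v := by
  induction hn : {z | T.le z v}.ncard using Nat.strong_induction_on generalizing v with
  | _ n ih =>
  subst hn
  by_cases hvr : v = r
  · subst hvr
    refine ⟨Walk.nil, Walk.IsPath.nil, fun z => ?_⟩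
    rw [Walk.support_nil, List.mem_singleton]
    constructor
    · rintro rfl
      exact hv
    · intro h
      exact T.antisymm h (T.root_le (T.refl_left h))
  · obtain ⟨x, h1, h2, h3, h4⟩ := T.pred hv hvr
    have hx : T.IsPred x v := ⟨h1, h2, h3, h4⟩
    obtain ⟨p, hp, hps⟩ := ih _ hx.ncard_lt x (T.refl_left h2) rfl
    have hadj : T.graph.Adj x v := Or.inl hx
    refine ⟨p.concat hadj, ?_, fun z => ?_⟩
    · rw [Walk.concat_isPath_iff]
      exact ⟨hp, fun h => h1 (T.antisymm h2 ((hps v).1 h))⟩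
    · rw [Walk.support_concat, List.mem_append, List.mem_singleton, hps]
      constructor
      · rintro (h | rfl)
        exacts [T.trans h h2, hv]
      · intro h
        exact (h4 z h).symm

/-- On a cycle, both neighbours of a vertex of greatest height would be its predecessor, but
predecessors are unique. -/
theorem graph_isAcyclic (T : NormalPartialTree G r) : T.graph.IsAcyclic := by
  classical
  intro v p hp
  obtain ⟨m, hm, hmax⟩ := p.support.toFinset.exists_max_image (fun x => {z | T.le z x}.ncard)
    ⟨v, by simp⟩
  rw [List.mem_toFinset] at hm
  have hq := hp.rotate hm
  have hmem : ∀ z ∈ (p.rotate m hm).support, {w | T.le w z}.ncard ≤ {w | T.le w m}.ncard := by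
    intro z hz
    exact hmax z (by simpa using (Walk.mem_support_rotate_iff p m hm).1 hz)
  have key : ∀ z ∈ (p.rotate m hm).support, T.graph.Adj m z → T.IsPred z m := by
    intro z hz hadj
    exact hadj.resolve_left fun h => absurd h.ncard_lt (not_lt.2 (hmem z hz))
  refine hq.snd_ne_penultimate ((key _ ?_ ?_).unique (key _ ?_ ?_))
  · exact Walk.getVert_mem_support _ _
  · exact Walk.adj_snd hq.not_nil
  · exact Walk.getVert_mem_support _ _
  · exact (Walk.adj_penultimate hq.not_nil).symm

theorem isNormalSpanningTree_graph (T : NormalPartialTree G r) (hT : ∀ v, T.le v v) :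
    IsNormalSpanningTree G T.graph r := by
  have hle : ∀ {u v}, T.le u v → TreeLE T.graph r u v := fun {u v} h =>
    let ⟨p, hp, hps⟩ := T.exists_isPath v (hT v)
    ⟨p, hp, (hps u).2 h⟩
  refine ⟨⟨?_, T.graph_isAcyclic⟩, ?_, fun u v huv => ?_⟩
  · rw [connected_iff_exists_forall_reachable]
    exact ⟨r, fun v => let ⟨p, _⟩ := T.exists_isPath v (hT v); ⟨p⟩⟩
  · rintro x y (h | h)
    exacts [h.2.2.1, h.2.2.1.symm]
  · exact (T.comparable (hT u) (hT v) huv).imp hle hle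

end NormalPartialTree

end SimpleGraph

theorem theorem3 {V : Type*} (G : SimpleGraph V) (hG : G.Connected) :
    G.HasNormalSpanningTree ↔
      ∃ U : ℕ → Set V, (∀ n, G.IsTKDispersed (U n)) ∧ ⋃ n, U n = Set.univ := by
  refine ⟨fun h => h.exists_isTKDispersed, ?_⟩
  rintro ⟨U, hU, hcov⟩
  obtain ⟨W, hmono, hW, hWcov⟩ := SimpleGraph.exists_monotone_isTKDispersed hU hcov
  obtain ⟨r⟩ := hG.nonempty
  obtain ⟨T, hT⟩ := SimpleGraph.NormalPartialTree.exists_carrier_eq_univ hG r hmono hW hWcov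
  exact ⟨T.graph, r, T.isNormalSpanningTree_graph hT⟩
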